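/- Let $(\Omega,\mathcal F,\mathbb P)$ be a probability space, $p,q\in[1,+\infty]$ conjugate exponents, $n\ge 1$, and $X=(X_1,\dots,X_n)^{\mathsf T}$ a random vector with components in $L^p$. Equip $L^p$ with its norm topology if $p<\infty$ and with the weak$^*$ topology $\sigma(L^\infty,L^1)$ if $p=\infty$. Let $\rho_1,\rho_2\colon L^p\to[-\infty,+\infty]$ be lower semicontinuous quasiconvex risk measures, i.e. $Y\le Z$ implies $\rho_j(Y)\ge\rho_j(Z)$, and $\rho_j(\lambda Y+(1-\lambda)Z)\le\max\{\rho_j(Y),\rho_j(Z)\}$ for $\lambda\in(0,1)$. Put $\mathscr A_j^t=\{Y\in L^p:\rho_j(Y)\le t\}$, $\alpha_j(V,t)=\sup_{Y\in\mathscr A_j^t}\mathbb E[-VY]$ for $V\in L^q_+$ (with $\sup\emptyset=-\infty$), $\mathcal W=\{w\in\mathbb R^n: w\ge 0,\ \mathbf 1^{\mathsf T}w=1\}$, and fix $r\in\mathbb R$. Let $p(r)=\inf\{\rho_1(w^{\mathsf T}X): w\in\mathcal W,\ \rho_2(w^{\mathsf T}X)\le r\}$. For $t\in\mathbb R$ consider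 the feasibility problem $$(\mathscr F^P(t,r))\qquad \text{find } w\in\mathcal W \text{ such that } w^{\mathsf T}X\in\mathscr A_1^t\cap\mathscr A_2^r,$$ with optimal value $f(t,r)=\inf_{w\in\mathcal W}\big(I_{\mathscr A_1^t}(w^{\mathsf T}X)+I_{\mathscr A_2^r}(w^{\mathsf T}X)\big)$, where $I_A$ is $0$ on $A$ and $+\infty$ off $A$, and the dual problem $$(\mathscr F^D(t,r))\qquad \text{maximize } -\alpha_1(V_1,t)-\alpha_2(V_2,r)-y \ \text{ subject to } \ \mathbb E[V_1X]+\mathbb E[V_2X]\le y\mathbf 1,\ V_1,V_2\in L^q_+,\ y\in\mathbb R$$ (componentwise inequality; $(+\infty)+(-\infty)=-\infty$ in the objective). (i) For every $t\in\mathbb R$: $f(t,r)=0$ if $(\mathscr F^P(t,r))$ has a solution and $f(t,r)=+\infty$ otherwise, and the optimal value of $(\mathscr F^D(t,r))$ equals $f(t,r)$. (ii) Let $t\in\mathbb R$. Suppose that there are $V_1,V_2\in L^q$ with $V_1,V_2>0$ almost surely and $\alpha_1(V_1,t),\alpha_2(V_2,r)\in\mathbb R$ (the Slater-type condition at $t$),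 and that $(\mathscr F^D(t,r))$ has an optimal solution. Then there is an optimal Lagrange multiplier of the inequality constraint of $(\mathscr F^D(t,r))$, that is, a vector $w^t\in\mathbb R^n_+$ such that $$\sup_{V_1,V_2\in L^q_+,\,y\in\mathbb R}\Big(-\alpha_1(V_1,t)-\alpha_2(V_2,r)-y-(w^t)^{\mathsf T}\big(\mathbb E[V_1X]+\mathbb E[V_2X]-y\mathbf 1\big)\Big)$$ is the optimal value of $(\mathscr F^D(t,r))$; and every such $w^t$ solves $(\mathscr F^P(t,r))$. (iii) Let $\varepsilon>0$ and let $\ell_0,u_0\in\mathbb R$ with $\ell_0\le p(r)\le u_0$. Given $(\ell_k,u_k)$, put $m_k=(\ell_k+u_k)/2$ and let $(\ell_{k+1},u_{k+1})=(\ell_k,m_k)$ if $f(m_k,r)=0$ and $(\ell_{k+1},u_{k+1})=(m_k,u_k)$ otherwise. Then $\ell_k\le p(r)\le u_k$ for all $k$, and $u_K-\ell_K\le\varepsilon$ for some $K\le\max\{0,\lceil\log_2((u_0-\ell_0)/\varepsilon)\rceil\}$ (for $K=0$ if $u_0=\ell_0$). Whenever $u_K-\ell_K\le\varepsilon$ and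 the Slater-type condition of (ii) holds at $t=u_K$, an optimal Lagrange multiplier of $(\mathscr F^D(u_K,r))$ exists, and every such multiplier $w$ is an $\varepsilon$-optimal portfolio: $w\in\mathcal W$, $\rho_2(w^{\mathsf T}X)\le r$ and $p(r)\le\rho_1(w^{\mathsf T}X)\le p(r)+\varepsilon$. If $X\ge 0$ almost surely, $\rho_1(\mathbf 1^{\mathsf T}X)\in\mathbb R$, and $w^0\in\mathcal W$ satisfies $\rho_1((w^0)^{\mathsf T}X)\in\mathbb R$ and $\rho_2((w^0)^{\mathsf T}X)\le r$, then $\ell_0=\rho_1(\mathbf 1^{\mathsf T}X)$ and $u_0=\rho_1((w^0)^{\mathsf T}X)$ are admissible starting values. -/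

import Mathlib

open MeasureTheory
open scoped ENNReal

namespace QCPortfolio

noncomputable section

/-- The duality pairing `𝔼[V Y]` of `V ∈ L^q` and `Y ∈ L^p`. -/
def pairing {Ω : Type*} [MeasurableSpace Ω] {P : Measure Ω} {p q : ℝ≥0∞}
    (V : Lp ℝ q P) (Y : Lp ℝ p P) : ℝ :=
  ∫ ω, V ω * Y ω ∂P

open Classical in
/-- The topology carried by `L^p`: the norm topology if `p < ∞`, and the weak-star topology
`σ(L^∞, L^1)` if `p = ∞` (with `q` the conjugate exponent, so that `q = 1` in that case). -/
@[reducible] def payoffTopology {Ω : Type*} [MeasurableSpace Ω] (P : Measure Ω) (p q : ℝ≥0∞)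
    [Fact (1 ≤ p)] : TopologicalSpace (Lp ℝ p P) :=
  if p = ∞ then
    TopologicalSpace.induced (fun (Y : Lp ℝ p P) (V : Lp ℝ q P) => pairing V Y)
      Pi.topologicalSpace
  else
    inferInstance

/-- Lower semicontinuous quasiconvex risk measures `ρ : L^p → [-∞, +∞]`. -/
structure IsLscQuasiconvexRiskMeasure {Ω : Type*} [MeasurableSpace Ω] (P : Measure Ω)
    (p q : ℝ≥0∞) [Fact (1 ≤ p)] (ρ : Lp ℝ p P → EReal) : Prop where
  monotone : ∀ Y₁ Y₂ : Lp ℝ p P, Y₁ ≤ Y₂ → ρ Y₂ ≤ ρ Y₁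
  quasiconvex : ∀ (Y₁ Y₂ : Lp ℝ p P) (c : ℝ), 0 < c → c < 1 →
    ρ (c • Y₁ + (1 - c) • Y₂) ≤ max (ρ Y₁) (ρ Y₂)
  lsc : @LowerSemicontinuous _ EReal (payoffTopology P p q) _ ρ

/-- The acceptance set of `ρ` at level `t`. -/
def acceptanceSet {Ω : Type*} [MeasurableSpace Ω] {P : Measure Ω} {p : ℝ≥0∞}
    (ρ : Lp ℝ p P → EReal) (t : ℝ) : Set (Lp ℝ p P) :=
  {Y | ρ Y ≤ (t : EReal)}

/-- The minimal penalty function `α(V, t) = sup {𝔼[-V Y] | ρ(Y) ≤ t}` of `ρ`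
(equal to `-∞` if the acceptance set is empty). -/
def penalty {Ω : Type*} [MeasurableSpace Ω] {P : Measure Ω} {p q : ℝ≥0∞}
    (ρ : Lp ℝ p P → EReal) (V : Lp ℝ q P) (t : ℝ) : EReal :=
  ⨆ Y ∈ acceptanceSet ρ t, ((-(pairing V Y) : ℝ) : EReal)

/-- The return `wᵀ X` of the portfolio `w`. -/
def portfolioReturn {Ω : Type*} [MeasurableSpace Ω] {P : Measure Ω} {p : ℝ≥0∞} {n : ℕ}
    (X : Fin n → Lp ℝ p P) (w : Fin n → ℝ) : Lp ℝ p P :=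
  ∑ i, w i • X i

open Classical in
/-- The convex-analytic indicator function of a set: `0` on the set and `+∞` off it. -/
def indicatorFn {E : Type*} (A : Set E) (x : E) : EReal :=
  if x ∈ A then 0 else ⊤

/-- The optimal value `p(r)` of minimising `ρ₁(wᵀX)` over the portfolios `w` (no short selling)
with `ρ₂(wᵀX) ≤ r`. -/
def portfolioValue {Ω : Type*} [MeasurableSpace Ω] {P : Measure Ω} {p : ℝ≥0∞} {n : ℕ}
    (ρ₁ ρ₂ : Lp ℝ p P → EReal) (X : Fin n → Lp ℝ p P) (r : ℝ) : EReal :=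
  ⨅ w ∈ {w | w ∈ stdSimplex ℝ (Fin n) ∧ ρ₂ (portfolioReturn X w) ≤ (r : EReal)},
    ρ₁ (portfolioReturn X w)

/-- `w` solves the feasibility problem: it is a portfolio whose return is accepted by `ρ₁` at
level `t` and by `ρ₂` at level `r`. -/
def SolvesFeasibility {Ω : Type*} [MeasurableSpace Ω] {P : Measure Ω} {p : ℝ≥0∞} {n : ℕ}
    (ρ₁ ρ₂ : Lp ℝ p P → EReal) (X : Fin n → Lp ℝ p P) (t r : ℝ) (w : Fin n → ℝ) : Prop :=
  w ∈ stdSimplex ℝ (Fin n) ∧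
    portfolioReturn X w ∈ acceptanceSet ρ₁ t ∩ acceptanceSet ρ₂ r

/-- The optimal value `f(t, r)` of the feasibility problem. -/
def feasibilityValue {Ω : Type*} [MeasurableSpace Ω] {P : Measure Ω} {p : ℝ≥0∞} {n : ℕ}
    (ρ₁ ρ₂ : Lp ℝ p P → EReal) (X : Fin n → Lp ℝ p P) (t r : ℝ) : EReal :=
  ⨅ w ∈ stdSimplex ℝ (Fin n),
    (indicatorFn (acceptanceSet ρ₁ t) (portfolioReturn X w) +
      indicatorFn (acceptanceSet ρ₂ r) (portfolioReturn X w))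

/-- The objective `-α₁(V₁, t) - α₂(V₂, r) - y` of the dual problem. In `EReal` the sum of `+∞`
and `-∞` is `-∞`, the convention for a maximisation problem. -/
def dualObjective {Ω : Type*} [MeasurableSpace Ω] {P : Measure Ω} {p q : ℝ≥0∞}
    (ρ₁ ρ₂ : Lp ℝ p P → EReal) (t r : ℝ) (V₁ V₂ : Lp ℝ q P) (y : ℝ) : EReal :=
  -penalty ρ₁ V₁ t - penalty ρ₂ V₂ r - (y : EReal)

/-- The feasible set of the dual problem: the triples `(V₁, V₂, y)` with `V₁, V₂ ∈ L^q_+` and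
`𝔼[V₁ X] + 𝔼[V₂ X] ≤ y 𝟏` componentwise. -/
def dualFeasible {Ω : Type*} [MeasurableSpace Ω] {P : Measure Ω} {p : ℝ≥0∞} (q : ℝ≥0∞) {n : ℕ}
    (X : Fin n → Lp ℝ p P) : Set (Lp ℝ q P × Lp ℝ q P × ℝ) :=
  {z | 0 ≤ z.1 ∧ 0 ≤ z.2.1 ∧ ∀ i, pairing z.1 (X i) + pairing z.2.1 (X i) ≤ z.2.2}

/-- The optimal value of the dual problem. -/
def dualValue {Ω : Type*} [MeasurableSpace Ω] {P : Measure Ω} {p : ℝ≥0∞} (q : ℝ≥0∞) {n : ℕ}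
    (ρ₁ ρ₂ : Lp ℝ p P → EReal) (X : Fin n → Lp ℝ p P) (t r : ℝ) : EReal :=
  ⨆ z ∈ dualFeasible q X, dualObjective ρ₁ ρ₂ t r z.1 z.2.1 z.2.2

/-- `(V₁, V₂, y)` is an optimal solution of the dual problem. -/
def IsDualOptimal {Ω : Type*} [MeasurableSpace Ω] {P : Measure Ω} {p q : ℝ≥0∞} {n : ℕ}
    (ρ₁ ρ₂ : Lp ℝ p P → EReal) (X : Fin n → Lp ℝ p P) (t r : ℝ)
    (V₁ V₂ : Lp ℝ q P) (y : ℝ) : Prop :=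
  (V₁, V₂, y) ∈ dualFeasible q X ∧
    dualObjective ρ₁ ρ₂ t r V₁ V₂ y = dualValue q ρ₁ ρ₂ X t r

/-- The Lagrangian of the dual problem, in which the constraint `𝔼[V₁ X] + 𝔼[V₂ X] ≤ y 𝟏` is
priced by `w`:
`-α₁(V₁, t) - α₂(V₂, r) - y - wᵀ (𝔼[V₁ X] + 𝔼[V₂ X] - y 𝟏)`. -/
def lagrangian {Ω : Type*} [MeasurableSpace Ω] {P : Measure Ω} {p q : ℝ≥0∞} {n : ℕ}
    (ρ₁ ρ₂ : Lp ℝ p P → EReal) (X : Fin n → Lp ℝ p P) (t r : ℝ) (w : Fin n → ℝ)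
    (V₁ V₂ : Lp ℝ q P) (y : ℝ) : EReal :=
  dualObjective ρ₁ ρ₂ t r V₁ V₂ y -
    ((∑ i, w i * (pairing V₁ (X i) + pairing V₂ (X i) - y) : ℝ) : EReal)

/-- `w` is an optimal Lagrange multiplier associated to the inequality constraint of the dual
problem: `w ≥ 0`, and the supremum of the Lagrangian at `w` over all `V₁, V₂ ∈ L^q_+` and `y ∈ ℝ`
is the optimal value of the dual problem. -/
def IsOptimalMultiplier {Ω : Type*} [MeasurableSpace Ω] {P : Measure Ω} {p : ℝ≥0∞} (q : ℝ≥0∞)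
    {n : ℕ} (ρ₁ ρ₂ : Lp ℝ p P → EReal) (X : Fin n → Lp ℝ p P) (t r : ℝ)
    (w : Fin n → ℝ) : Prop :=
  (∀ i, 0 ≤ w i) ∧
    (⨆ z ∈ {z : Lp ℝ q P × Lp ℝ q P × ℝ | 0 ≤ z.1 ∧ 0 ≤ z.2.1},
      lagrangian ρ₁ ρ₂ X t r w z.1 z.2.1 z.2.2) = dualValue q ρ₁ ρ₂ X t r

/-- The constraint qualification at `t`: there are almost surely strictly positive
`V₁, V₂ ∈ L^q` with `α₁(V₁, t)` and `α₂(V₂, r)` finite. -/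
def SlaterCondition {Ω : Type*} [MeasurableSpace Ω] {P : Measure Ω} {p : ℝ≥0∞} (q : ℝ≥0∞)
    (ρ₁ ρ₂ : Lp ℝ p P → EReal) (t r : ℝ) : Prop :=
  ∃ V₁ V₂ : Lp ℝ q P, (∀ᵐ ω ∂P, 0 < V₁ ω) ∧ (∀ᵐ ω ∂P, 0 < V₂ ω) ∧
    (∃ a : ℝ, penalty ρ₁ V₁ t = (a : EReal)) ∧ (∃ a : ℝ, penalty ρ₂ V₂ r = (a : EReal))

open Classical in
/-- The interval `(ℓ_k, u_k)` after `k` steps of the bisection method started at `(ℓ, u)`: a step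
computes `f(m, r)` at the midpoint `m`, and keeps the left half if this value is `0` and the right
half otherwise. -/
def bisection {Ω : Type*} [MeasurableSpace Ω] {P : Measure Ω} {p : ℝ≥0∞} {n : ℕ}
    (ρ₁ ρ₂ : Lp ℝ p P → EReal) (X : Fin n → Lp ℝ p P) (r l u : ℝ) : ℕ → ℝ × ℝ
  | 0 => (l, u)
  | k + 1 =>
    let I := bisection ρ₁ ρ₂ X r l u k
    let m := (I.1 + I.2) / 2
    if feasibilityValue ρ₁ ρ₂ X m r = 0 then (I.1, m) else (m, I.2)

end

end QCPortfolio

open QCPortfolio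

open scoped NNReal

namespace QCPortfolio

/-! ### From positive functionals on `L^p`, `p < ∞`, to measures. -/

section Riesz

variable {Ω : Type*} [MeasurableSpace Ω] {P : Measure Ω} [IsProbabilityMeasure P]
  {p q : ℝ≥0∞}

/-! The acceptance sets are convex, closed and upper. If no portfolio return lies in both, the
diagonal copy of the simplex in `L^p × L^p` is compact, convex and disjoint from their product. When
both sets are nonempty, Hahn-Banach separates strictly, and upperness makes both functionals
positive, hence elements of `L^q_+` (`exists_nonneg_separation`). Scaling the separating pair drives
the dual objective to `+∞`. In the feasible case weak duality bounds the dual by `0`, attained at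
the origin.

A dual optimum over nonempty acceptance sets has objective below `+∞`, so the primal is feasible.
The Lagrangian at a feasible portfolio has supremum `0`, so it is an optimal multiplier. Conversely,
testing the Lagrangian at `(0, 0, y)` forces the weights of a multiplier to sum to `1`, and testing
it at a single `V` shows that no `V` separates its return from either acceptance set
(`solves_of_isOptimalMultiplier`).

For the bisection, compactness of the simplex and lower semicontinuity make `p(r)` attained when it
is finite, so every upper end `u_K` is a feasible level. Its multipliers then have risk at most `u_K
≤ ℓ_K + ε ≤ p(r) + ε`. -/

lemma indicatorConstLp_one_nonneg {s : Set Ω} (hs : MeasurableSet s) :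
    0 ≤ indicatorConstLp p hs (measure_ne_top P s) (1 : ℝ) := by
  rw [← Lp.coeFn_nonneg]
  filter_upwards [indicatorConstLp_coeFn (p := p) (hs := hs) (hμs := measure_ne_top P s)
    (c := (1 : ℝ))] with ω h
  rw [h]
  exact Set.indicator_nonneg (fun _ _ => zero_le_one) ω

variable [Fact (1 ≤ p)]

lemma functional_indicator_accumulate (φ : Lp ℝ p P →L[ℝ] ℝ) {f : ℕ → Set Ω}
    (hf : ∀ i, MeasurableSet (f i)) (hd : Pairwise (Function.onFun Disjoint f)) (n : ℕ)
    (hm : MeasurableSet (⋃ i ∈ Finset.range n, f i)) :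
    φ (indicatorConstLp p hm (measure_ne_top P _) (1 : ℝ)) =
      ∑ i ∈ Finset.range n, φ (indicatorConstLp p (hf i) (measure_ne_top P _) (1 : ℝ)) := by
  induction n with
  | zero => simp
  | succ n ih =>
    have hm' : MeasurableSet (⋃ i ∈ Finset.range n, f i) :=
      Finset.measurableSet_biUnion _ fun i _ => hf i
    have hdis : Disjoint (⋃ i ∈ Finset.range n, f i) (f n) := by
      rw [Set.disjoint_iUnion₂_left]
      intro i hi
      exact hd (Finset.mem_range.1 hi).ne
    have hU : (⋃ i ∈ Finset.range (n + 1), f i) = (⋃ i ∈ Finset.range n, f i) ∪ f n := by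
      rw [Finset.range_add_one, Finset.set_biUnion_insert, Set.union_comm]
    rw [Finset.sum_range_succ, ← ih hm', ← map_add,
      ← indicatorConstLp_disjoint_union hm' (hf n) (measure_ne_top P _) (measure_ne_top P _) hdis]
    congr 2

/-- For `p < ∞` the indicators of the partial unions converge in norm, because the measure of what
is missing tends to `0`. Continuity of `φ` then upgrades finite to countable additivity. -/
lemma functional_hasSum_indicator (hp : p ≠ ∞) (φ : Lp ℝ p P →L[ℝ] ℝ)
    (hφ : ∀ Y, 0 ≤ Y → 0 ≤ φ Y) {f : ℕ → Set Ω}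
    (hf : ∀ i, MeasurableSet (f i)) (hd : Pairwise (Function.onFun Disjoint f)) :
    HasSum (fun i => φ (indicatorConstLp p (hf i) (measure_ne_top P _) (1 : ℝ)))
      (φ (indicatorConstLp p (MeasurableSet.iUnion hf) (measure_ne_top P _) (1 : ℝ))) := by
  rw [hasSum_iff_tendsto_nat_of_nonneg (fun i => hφ _ (indicatorConstLp_one_nonneg (hf i)))]
  have hm : ∀ n, MeasurableSet (⋃ i ∈ Finset.range n, f i) := fun n =>
    Finset.measurableSet_biUnion _ fun i _ => hf i
  simp_rw [← fun n => functional_indicator_accumulate φ hf hd n (hm n)]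
  refine (φ.continuous.tendsto _).comp ?_
  refine tendsto_indicatorConstLp_set hp ?_
  have hmono : Monotone fun n => ⋃ i ∈ Finset.range n, f i := fun a b hab =>
    Set.biUnion_subset_biUnion_left (by simpa using hab)
  have hU : (⋃ n, ⋃ i ∈ Finset.range n, f i) = ⋃ i, f i := by
    ext ω
    simp only [Set.mem_iUnion, Finset.mem_range, exists_prop]
    exact ⟨fun ⟨_, i, _, h⟩ => ⟨i, h⟩, fun ⟨i, h⟩ => ⟨i + 1, i, i.lt_succ_self, h⟩⟩
  have hsub : ∀ n, (⋃ i ∈ Finset.range n, f i) ⊆ ⋃ i, f i := fun n => by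
    rw [← hU]; exact Set.subset_iUnion (fun n => ⋃ i ∈ Finset.range n, f i) n
  have h1 : ∀ n, symmDiff (⋃ i ∈ Finset.range n, f i) (⋃ i, f i) =
      (⋃ i, f i) \ ⋃ i ∈ Finset.range n, f i := fun n => by
    rw [symmDiff_def, sdiff_eq_bot_iff.2 (hsub n), bot_sup_eq]
  simp_rw [h1]
  have h2 := tendsto_measure_iInter_atTop (μ := P)
    (s := fun n => (⋃ i, f i) \ ⋃ i ∈ Finset.range n, f i)
    (fun n => ((MeasurableSet.iUnion hf).diff (hm n)).nullMeasurableSet)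
    (fun a b hab => Set.sdiff_subset_sdiff_right (hmono hab)) ⟨0, measure_ne_top _ _⟩
  rwa [← Set.sdiff_iUnion, hU, Set.sdiff_self, measure_empty] at h2

/-- A positive continuous functional on `L^p`, `p < ∞`, is represented on indicators by a finite
measure absolutely continuous with respect to `P`. -/
lemma exists_measure_of_positive_functional (hp : p ≠ ∞) (φ : Lp ℝ p P →L[ℝ] ℝ)
    (hφ : ∀ Y, 0 ≤ Y → 0 ≤ φ Y) :
    ∃ ν : Measure Ω, IsFiniteMeasure ν ∧ ν ≪ P ∧ ∀ (s : Set Ω) (hs : MeasurableSet s),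
      φ (indicatorConstLp p hs (measure_ne_top P s) (1 : ℝ)) = ν.real s := by
  have hpos : ∀ (s : Set Ω) (hs : MeasurableSet s),
      0 ≤ φ (indicatorConstLp p hs (measure_ne_top P s) (1 : ℝ)) := fun s hs =>
    hφ _ (indicatorConstLp_one_nonneg hs)
  let ν : Measure Ω := Measure.ofMeasurable
    (fun s hs => ENNReal.ofReal (φ (indicatorConstLp p hs (measure_ne_top P s) (1 : ℝ))))
    (by simp)
    (fun f hf hd => by
      have h := functional_hasSum_indicator hp φ hφ hf hd
      rw [← h.tsum_eq, ENNReal.ofReal_tsum_of_nonneg (fun i => hpos _ (hf i)) h.summable])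
  have hν : ∀ (s : Set Ω) (hs : MeasurableSet s),
      ν s = ENNReal.ofReal (φ (indicatorConstLp p hs (measure_ne_top P s) (1 : ℝ))) :=
    fun s hs => Measure.ofMeasurable_apply s hs
  refine ⟨ν, ⟨by rw [hν _ MeasurableSet.univ]; exact ENNReal.ofReal_lt_top⟩, ?_, fun s hs => ?_⟩
  · refine Measure.AbsolutelyContinuous.mk fun s hs h0 => ?_
    have : indicatorConstLp p hs (measure_ne_top P s) (1 : ℝ) = 0 := by
      rw [← norm_eq_zero, norm_indicatorConstLp (zero_lt_one.trans_le Fact.out).ne' hp,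
        measureReal_def, h0, ENNReal.toReal_zero, Real.zero_rpow, mul_zero]
      have h1 : (1 : ℝ≥0∞) ≤ p := Fact.out
      exact one_div_ne_zero (ENNReal.toReal_pos (zero_lt_one.trans_le h1).ne' hp).ne'
    rw [hν s hs, this, map_zero, ENNReal.ofReal_zero]
  · rw [measureReal_def, hν s hs, ENNReal.toReal_ofReal (hpos s hs)]

lemma functional_simpleFunc_eq_integral (φ : Lp ℝ p P →L[ℝ] ℝ)
    {ν : Measure Ω} [IsFiniteMeasure ν]
    (hν : ∀ (s : Set Ω) (hs : MeasurableSet s),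
      φ (indicatorConstLp p hs (measure_ne_top P s) (1 : ℝ)) = ν.real s)
    (f : SimpleFunc Ω ℝ) (hf : MemLp f p P) : φ (hf.toLp f) = ∫ ω, f ω ∂ν := by
  induction f using SimpleFunc.induction with
  | const c hs =>
    rename_i s
    have h1 : hf.toLp _ = c • indicatorConstLp p hs (measure_ne_top P s) (1 : ℝ) := by
      rw [indicatorConstLp, ← MemLp.toLp_const_smul]
      refine MemLp.toLp_congr _ _ (Filter.Eventually.of_forall fun ω => ?_)
      by_cases h : ω ∈ s <;> simp [h]
    rw [h1, map_smul, hν s hs, smul_eq_mul]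
    have h2 : ∀ ω, (SimpleFunc.piecewise s hs (SimpleFunc.const Ω c) (SimpleFunc.const Ω 0)) ω =
        s.indicator (fun _ => c) ω := fun ω => by
      by_cases h : ω ∈ s <;> simp [h]
    simp_rw [h2]
    rw [integral_indicator_const c hs, smul_eq_mul, mul_comm]
  | add hd ihf ihg =>
    rename_i f g
    have hf' : MemLp f p P := SimpleFunc.memLp_of_isFiniteMeasure f p P
    have hg' : MemLp g p P := SimpleFunc.memLp_of_isFiniteMeasure g p P
    have : hf.toLp _ = hf'.toLp f + hg'.toLp g := rfl
    rw [this, map_add, ihf, ihg]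
    simp only [SimpleFunc.coe_add, Pi.add_apply]
    exact (integral_add (SimpleFunc.integrable_of_isFiniteMeasure f)
      (SimpleFunc.integrable_of_isFiniteMeasure g)).symm

/-- The bound on simple functions below `g` is continuity of `φ`. It is the input that the converse
Hölder inequality needs to place the density of `ν` in `L^q`. -/
lemma lintegral_le_norm_mul_eLpNorm (φ : Lp ℝ p P →L[ℝ] ℝ)
    {ν : Measure Ω} [IsFiniteMeasure ν]
    (hν : ∀ (s : Set Ω) (hs : MeasurableSet s),
      φ (indicatorConstLp p hs (measure_ne_top P s) (1 : ℝ)) = ν.real s)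
    (g : Ω → ℝ≥0∞) : ∫⁻ ω, g ω ∂ν ≤ ‖φ‖ₑ * eLpNorm g p P := by
  rw [lintegral_eq_nnreal]
  refine iSup₂_le fun f hfg => ?_
  set F : SimpleFunc Ω ℝ := f.map ((↑) : ℝ≥0 → ℝ) with hF
  have hFm : MemLp F p P := SimpleFunc.memLp_of_isFiniteMeasure F p P
  have h1 : (f.map ((↑) : ℝ≥0 → ℝ≥0∞)).lintegral ν = ENNReal.ofReal (φ (hFm.toLp F)) := by
    rw [functional_simpleFunc_eq_integral φ hν F hFm,
      ofReal_integral_eq_lintegral_ofReal (SimpleFunc.integrable_of_isFiniteMeasure F)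
        (Filter.Eventually.of_forall fun ω => (f ω).2), ← SimpleFunc.lintegral_eq_lintegral]
    refine lintegral_congr fun ω => ?_
    simp [hF]
  have h2 : eLpNorm F p P ≤ eLpNorm g p P := by
    refine eLpNorm_mono_enorm fun ω => ?_
    simpa [hF] using hfg ω
  calc (f.map ((↑) : ℝ≥0 → ℝ≥0∞)).lintegral ν = ENNReal.ofReal (φ (hFm.toLp F)) := h1
    _ ≤ ‖φ (hFm.toLp F)‖ₑ := Real.ofReal_le_enorm _
    _ ≤ ‖φ‖ₑ * ‖hFm.toLp F‖ₑ := φ.le_opENorm _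
    _ = ‖φ‖ₑ * eLpNorm F p P := by rw [Lp.enorm_toLp]
    _ ≤ ‖φ‖ₑ * eLpNorm g p P := by gcongr

end Riesz

end QCPortfolio

open scoped NNReal

namespace QCPortfolio

/-! ### Converse Hölder inequality. -/

section RieszDensity

variable {Ω : Type*} [MeasurableSpace Ω] {P : Measure Ω} [IsProbabilityMeasure P]

/-- The part of the converse Hölder inequality with both exponents finite. -/
lemma lintegral_rpow_le_of_forall_lintegral_mul_le {a b : ℝ} (hab : a.HolderConjugate b)
    {V : Ω → ℝ≥0∞} (hV : Measurable V) {C : ℝ≥0∞}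
    (h : ∀ g : Ω → ℝ≥0∞, Measurable g →
      ∫⁻ ω, V ω * g ω ∂P ≤ C * (∫⁻ ω, g ω ^ a ∂P) ^ (1 / a)) :
    ∫⁻ ω, V ω ^ b ∂P ≤ C ^ b := by
  have hb : 0 < b := hab.symm.pos
  have hb1 : 0 < b - 1 := hab.symm.sub_one_pos
  -- Truncation makes `I = ∫ g ^ b` finite. Testing against `g ^ (b - 1)` gives `I ≤ C * I ^ (1 /
  -- a)`, and finiteness permits the division. Monotone convergence removes the truncation.
  let g : ℕ → Ω → ℝ≥0∞ := fun k ω => min (V ω) k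
  have hg : ∀ k, Measurable (g k) := fun k => hV.min measurable_const
  have hk : ∀ k, ∫⁻ ω, g k ω ^ b ∂P ≤ C ^ b := by
    intro k
    set I := ∫⁻ ω, g k ω ^ b ∂P with hI
    have hIfin : I ≠ ∞ := by
      have : I ≤ ∫⁻ _, (k : ℝ≥0∞) ^ b ∂P :=
        lintegral_mono fun ω => ENNReal.rpow_le_rpow (min_le_right _ _) hb.le
      refine ne_top_of_le_ne_top ?_ this
      simpa using ENNReal.rpow_ne_top_of_nonneg hb.le (ENNReal.natCast_ne_top k)
    have h1 : I ≤ C * I ^ (1 / a) := by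
      calc I ≤ ∫⁻ ω, V ω * g k ω ^ (b - 1) ∂P := by
            refine lintegral_mono fun ω => ?_
            calc g k ω ^ b = g k ω ^ (1 + (b - 1)) := by congr 1; ring
              _ = g k ω * g k ω ^ (b - 1) := by
                rw [ENNReal.rpow_add_of_nonneg _ _ zero_le_one hb1.le, ENNReal.rpow_one]
              _ ≤ V ω * g k ω ^ (b - 1) := by gcongr; exact min_le_left _ _
        _ ≤ C * (∫⁻ ω, (g k ω ^ (b - 1)) ^ a ∂P) ^ (1 / a) := h _ ((hg k).pow_const _)
        _ = C * I ^ (1 / a) := by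
            simp_rw [← ENNReal.rpow_mul, hab.symm.sub_one_mul_conj, hI]
    rcases eq_or_ne I 0 with h0 | h0
    · rw [h0]; exact zero_le
    have h2 : I ^ (1 / b) * I ^ (1 / a) = I := by
      rw [← ENNReal.rpow_add _ _ h0 hIfin, one_div, one_div, add_comm, hab.inv_add_inv_eq_one,
        ENNReal.rpow_one]
    have h3 : I ^ (1 / b) ≤ C := by
      have h4 : I ^ (1 / a) ≠ 0 := by
        simp [ENNReal.rpow_eq_zero_iff, h0, hIfin]
      have h5 : I ^ (1 / a) ≠ ∞ := ENNReal.rpow_ne_top_of_nonneg (by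
        have := hab.pos; positivity) hIfin
      rw [← ENNReal.mul_le_mul_iff_left h4 h5, h2]
      exact h1
    calc I = (I ^ (1 / b)) ^ b := by
          rw [← ENNReal.rpow_mul, one_div_mul_cancel hb.ne', ENNReal.rpow_one]
      _ ≤ C ^ b := ENNReal.rpow_le_rpow h3 hb.le
  refine le_of_tendsto' (lintegral_tendsto_of_tendsto_of_monotone
    (f := fun k ω => g k ω ^ b) (fun k => ((hg k).pow_const b).aemeasurable)
    (Filter.Eventually.of_forall fun ω i j hij => ?_)
    (Filter.Eventually.of_forall fun ω => ?_)) hk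
  · exact ENNReal.rpow_le_rpow (min_le_min_left _ (by exact_mod_cast hij)) hb.le
  · have h1 : Filter.Tendsto (fun k : ℕ => g k ω) Filter.atTop (nhds (min (V ω) ∞)) :=
      tendsto_const_nhds.min ENNReal.tendsto_nat_nhds_top
    rw [min_top_right] at h1
    exact (ENNReal.continuous_rpow_const.tendsto _).comp h1

/-- Converse Hölder inequality: a density pairing boundedly with `L^p` lies in `L^q`. -/
lemma eLpNorm_lt_top_of_forall_lintegral_mul_le {p q : ℝ≥0∞} [hp1 : Fact (1 ≤ p)] (hp : p ≠ ∞)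
    (hpq : p.HolderConjugate q) {V : Ω → ℝ≥0∞} (hV : Measurable V) {C : ℝ≥0∞} (hC : C ≠ ∞)
    (h : ∀ g : Ω → ℝ≥0∞, Measurable g → ∫⁻ ω, V ω * g ω ∂P ≤ C * eLpNorm g p P) :
    eLpNorm V q P < ∞ := by
  have hp0 : p ≠ 0 := (zero_lt_one.trans_le hp1.out).ne'
  rcases eq_or_ne p 1 with rfl | hne
  · have hq : q = ∞ := (ENNReal.HolderConjugate.eq_top_iff_eq_one q 1).2 rfl
    rw [hq, eLpNorm_exponent_top]
    refine lt_of_le_of_lt (eLpNormEssSup_le_of_ae_enorm_bound (C := C) ?_) hC.lt_top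
    refine ae_le_of_forall_setLIntegral_le_of_sigmaFinite hV fun s hs _ => ?_
    -- Against indicators the hypothesis reads `∫ V ≤ C * P s` over every `s`, which forces `V ≤ C`
    -- almost everywhere.
    have h1 := h (s.indicator 1) (measurable_one.indicator hs)
    have h2 : ∀ ω, V ω * s.indicator 1 ω = s.indicator V ω := fun ω => by
      by_cases hω : ω ∈ s <;> simp [hω]
    simp_rw [h2] at h1
    rw [lintegral_indicator hs, eLpNorm_one_eq_lintegral_enorm] at h1
    refine h1.trans (le_of_eq ?_)
    simp only [enorm_eq_self]
    rw [lintegral_indicator_one hs, setLIntegral_const]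
  · have hq : q ≠ ∞ := fun h' => hne ((ENNReal.HolderConjugate.eq_top_iff_eq_one q p).1 h')
    have hq0 : q ≠ 0 := (ENNReal.HolderConjugate.pos q p).ne'
    have hab : p.toReal.HolderConjugate q.toReal := ENNReal.HolderConjugate.toReal_of_ne_top hp hq
    have h1 := lintegral_rpow_le_of_forall_lintegral_mul_le (P := P) hab hV (C := C) fun g hg => by
      simpa [eLpNorm_eq_lintegral_rpow_enorm_toReal hp0 hp] using h g hg
    rw [eLpNorm_eq_lintegral_rpow_enorm_toReal hq0 hq]
    refine ENNReal.rpow_lt_top_of_nonneg (by positivity) (ne_top_of_le_ne_top ?_ h1)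
    exact ENNReal.rpow_ne_top_of_nonneg (by positivity) hC

end RieszDensity

end QCPortfolio

namespace QCPortfolio

/-! ### The dual of `L^p` in its payoff topology. -/

section Pairing

variable {Ω : Type*} [MeasurableSpace Ω] {P : Measure Ω} {p q : ℝ≥0∞} [hp1 : Fact (1 ≤ p)]

omit hp1 in
lemma one_le_of_holderConjugate (hpq : p.HolderConjugate q) : 1 ≤ q :=
  ENNReal.HolderConjugate.one_le q p

/-- The pairing of `L^p` and `L^q` as a bilinear map. -/
noncomputable def pairingₗ (P : Measure Ω) (hpq : p.HolderConjugate q) :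
    Lp ℝ p P →ₗ[ℝ] Lp ℝ q P →ₗ[ℝ] ℝ :=
  haveI : Fact (1 ≤ q) := ⟨one_le_of_holderConjugate hpq⟩
  LinearMap.mk₂ ℝ (fun Y V => (ContinuousLinearMap.mul ℝ ℝ).lpPairing P p q Y V)
    (by simp) (by simp) (by simp) (by simp)

lemma pairing_eq_pairingₗ (hpq : p.HolderConjugate q) (V : Lp ℝ q P) (Y : Lp ℝ p P) :
    pairing V Y = pairingₗ P hpq Y V := by
  have : Fact (1 ≤ q) := ⟨one_le_of_holderConjugate hpq⟩
  simp only [pairingₗ, LinearMap.mk₂_apply, ContinuousLinearMap.lpPairing_eq_integral, pairing,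
    ContinuousLinearMap.mul_apply', mul_comm]

lemma continuous_pairing_right (hpq : p.HolderConjugate q) (V : Lp ℝ q P) :
    Continuous fun Y : Lp ℝ p P => pairing V Y := by
  have : Fact (1 ≤ q) := ⟨one_le_of_holderConjugate hpq⟩
  have : (fun Y : Lp ℝ p P => pairing V Y) =
      fun Y => (ContinuousLinearMap.mul ℝ ℝ).lpPairing P p q Y V := by
    funext Y
    rw [pairing_eq_pairingₗ hpq]; rfl
  rw [this]
  fun_prop

omit hp1 in
lemma pairing_indicatorConstLp (V : Lp ℝ q P) {s : Set Ω} (hs : MeasurableSet s)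
    (hμ : P s ≠ ∞) (c : ℝ) :
    pairing V (indicatorConstLp p hs hμ c) = c * ∫ ω in s, V ω ∂P := by
  rw [pairing, ← integral_const_mul, ← integral_indicator hs]
  refine integral_congr_ae ?_
  filter_upwards [indicatorConstLp_coeFn (p := p) (hs := hs) (hμs := hμ) (c := c)] with ω h
  rw [h]
  by_cases hω : ω ∈ s <;> simp [hω, mul_comm]

variable [IsProbabilityMeasure P]

/-- **Riesz representation** of positive continuous functionals on `L^p`, `p < ∞`. -/
lemma exists_pairing_eq_of_positive (hpq : p.HolderConjugate q) (hp : p ≠ ∞)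
    (φ : Lp ℝ p P →L[ℝ] ℝ) (hφ : ∀ Y, 0 ≤ Y → 0 ≤ φ Y) :
    ∃ V : Lp ℝ q P, ∀ Y, φ Y = pairing V Y := by
  obtain ⟨ν, hfin, hac, hν⟩ := exists_measure_of_positive_functional hp φ hφ
  have hVq : eLpNorm (ν.rnDeriv P) q P < ∞ :=
    eLpNorm_lt_top_of_forall_lintegral_mul_le hp hpq (ν.measurable_rnDeriv P)
      (C := ‖φ‖ₑ) enorm_ne_top fun g hg => by
        rw [lintegral_rnDeriv_mul hac hg.aemeasurable]
        exact lintegral_le_norm_mul_eLpNorm φ hν g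
  have hmem : MemLp (fun ω => (ν.rnDeriv P ω).toReal) q P := by
    refine ⟨(ν.measurable_rnDeriv P).ennreal_toReal.aestronglyMeasurable,
      lt_of_le_of_lt (eLpNorm_mono_enorm fun ω => ?_) hVq⟩
    rw [Real.enorm_eq_ofReal ENNReal.toReal_nonneg]
    exact ENNReal.ofReal_toReal_le
  refine ⟨hmem.toLp _, fun Y => ?_⟩
  induction Y using Lp.induction hp with
  | indicatorConst c hs hμ =>
    rename_i s
    rw [Lp.simpleFunc.coe_indicatorConst, pairing_indicatorConstLp]
    have h1 : indicatorConstLp p hs hμ.ne c =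
        c • indicatorConstLp p hs (measure_ne_top P s) (1 : ℝ) := by
      rw [indicatorConstLp, indicatorConstLp, ← MemLp.toLp_const_smul]
      refine MemLp.toLp_congr _ _ (Filter.Eventually.of_forall fun ω => ?_)
      by_cases h : ω ∈ s <;> simp [h]
    rw [h1, map_smul, hν s hs, smul_eq_mul, ← Measure.setIntegral_toReal_rnDeriv hac s,
      setIntegral_congr_ae hs (hmem.coeFn_toLp.mono fun ω h _ => h)]
  | add hf hg _ ihf ihg =>
    rw [map_add, ihf, ihg, pairing_eq_pairingₗ hpq, pairing_eq_pairingₗ hpq,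
      pairing_eq_pairingₗ hpq, map_add, LinearMap.add_apply]
  | isClosed => exact isClosed_eq φ.continuous (continuous_pairing_right hpq _)

omit hp1 in
lemma nonneg_of_forall_pairing_nonneg (hq : 1 ≤ q) (V : Lp ℝ q P)
    (h : ∀ Y : Lp ℝ p P, 0 ≤ Y → 0 ≤ pairing V Y) : 0 ≤ V := by
  rw [← Lp.coeFn_nonneg]
  refine ae_nonneg_of_forall_setIntegral_nonneg ((Lp.memLp V).integrable hq) fun s hs _ => ?_
  have := h _ (indicatorConstLp_one_nonneg hs)
  rwa [pairing_indicatorConstLp, one_mul] at this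

omit [IsProbabilityMeasure P] in
-- Gives access to the general theory of weak topologies: local convexity, and the fact that every
-- continuous functional comes from the pairing.
lemma payoffTopology_eq_weakBilin (hpq : p.HolderConjugate q) (hp : p = ∞) :
    payoffTopology P p q = WeakBilin.instTopologicalSpace (pairingₗ P hpq) := by
  rw [payoffTopology, if_pos hp, WeakBilin.instTopologicalSpace]
  congr 1
  funext Y V
  exact pairing_eq_pairingₗ hpq V Y

omit [IsProbabilityMeasure P] in
lemma payoffTopology_locallyConvex (hpq : p.HolderConjugate q) :
    @IsTopologicalAddGroup (Lp ℝ p P) (payoffTopology P p q) _ ∧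
      @ContinuousSMul ℝ (Lp ℝ p P) _ _ (payoffTopology P p q) ∧
      @LocallyConvexSpace ℝ (Lp ℝ p P) _ _ _ _ (payoffTopology P p q) := by
  by_cases hp : p = ∞
  · rw [payoffTopology_eq_weakBilin hpq hp]
    exact ⟨WeakBilin.instIsTopologicalAddGroup (pairingₗ P hpq),
      WeakBilin.instContinuousSMul (pairingₗ P hpq),
      (inferInstance : LocallyConvexSpace ℝ (WeakBilin (pairingₗ P hpq)))⟩
  · rw [payoffTopology, if_neg hp]
    exact ⟨inferInstance, inferInstance, inferInstance⟩

/-- Positive functionals continuous for the topology of `L^p` are represented by `L^q_+`. -/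
lemma exists_nonneg_pairing_eq (hpq : p.HolderConjugate q) (φ : Lp ℝ p P →ₗ[ℝ] ℝ)
    (hc : @Continuous _ _ (payoffTopology P p q) _ φ) (hφ : ∀ Y, 0 ≤ Y → 0 ≤ φ Y) :
    ∃ V : Lp ℝ q P, 0 ≤ V ∧ ∀ Y, φ Y = pairing V Y := by
  obtain ⟨V, hV⟩ : ∃ V : Lp ℝ q P, ∀ Y, φ Y = pairing V Y := by
    by_cases hp : p = ∞
    · rw [payoffTopology_eq_weakBilin hpq hp] at hc
      obtain ⟨V, hV⟩ := LinearMap.dualEmbedding_surjective (pairingₗ P hpq)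
        (⟨φ, hc⟩ : StrongDual ℝ (WeakBilin (pairingₗ P hpq)))
      refine ⟨V, fun Y => ?_⟩
      rw [pairing_eq_pairingₗ hpq]
      exact (DFunLike.congr_fun hV Y).symm
    · rw [payoffTopology, if_neg hp] at hc
      exact exists_pairing_eq_of_positive hpq hp ⟨φ, hc⟩ hφ
  exact ⟨V, nonneg_of_forall_pairing_nonneg (one_le_of_holderConjugate hpq) V
    fun Y hY => hV Y ▸ hφ Y hY, hV⟩

end Pairing

/-! ### Hahn-Banach separation from a simplex. -/

section Separation

variable {E : Type*} [AddCommGroup E] [Module ℝ E] [TopologicalSpace E]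
  [IsTopologicalAddGroup E] [ContinuousSMul ℝ E]

lemma continuous_sum_smul {n : ℕ} (X : Fin n → E) :
    Continuous fun w : Fin n → ℝ => ∑ i, w i • X i := by
  fun_prop

/-- Separation of a product of closed convex sets from the diagonal copy of a simplex. -/
lemma exists_separation_simplex [LocallyConvexSpace ℝ E] {n : ℕ} (X : Fin n → E)
    {A₁ A₂ : Set E} (hA₁ : Convex ℝ A₁) (hA₂ : Convex ℝ A₂) (hc₁ : IsClosed A₁)
    (hc₂ : IsClosed A₂)
    (h : ∀ w ∈ stdSimplex ℝ (Fin n), ∑ i, w i • X i ∈ A₁ → ∑ i, w i • X i ∉ A₂) :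
    ∃ (f g : E →L[ℝ] ℝ) (c d : ℝ), c < d ∧ (∀ i, f (X i) + g (X i) ≤ c) ∧
      ∀ Y₁ ∈ A₁, ∀ Y₂ ∈ A₂, d ≤ f Y₁ + g Y₂ := by
  let T : (Fin n → ℝ) →ₗ[ℝ] E := Fintype.linearCombination ℝ X
  have hT : ∀ w, T w = ∑ i, w i • X i := fun w => Fintype.linearCombination_apply ℝ X w
  have hTc : Continuous T := by
    rw [show (T : (Fin n → ℝ) → E) = _ from funext hT]; exact continuous_sum_smul X
  obtain ⟨F, c, d, hF, hcd, hd⟩ := geometric_hahn_banach_compact_closed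
    (s := (T.prod T) '' stdSimplex ℝ (Fin n)) (t := A₁ ×ˢ A₂)
    ((convex_stdSimplex ℝ (Fin n)).linear_image _)
    ((isCompact_stdSimplex ℝ (Fin n)).image (hTc.prodMk hTc)) (hA₁.prod hA₂) (hc₁.prod hc₂) (by
      rw [Set.disjoint_left]
      rintro _ ⟨w, hw, rfl⟩ hm
      have h1 : T w ∈ A₁ := hm.1
      have h2 : T w ∈ A₂ := hm.2
      rw [hT] at h1 h2
      exact h w hw h1 h2)
  have hsplit : ∀ a b, F (a, b) =
      (F.comp (ContinuousLinearMap.inl ℝ E E)) a + (F.comp (ContinuousLinearMap.inr ℝ E E)) b := by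
    intro a b
    simp [← map_add]
  refine ⟨F.comp (.inl ℝ E E), F.comp (.inr ℝ E E), c, d, hcd, fun i => ?_,
    fun Y₁ h₁ Y₂ h₂ => ?_⟩
  -- The vertices of the simplex produce exactly the componentwise dual constraint.
  · have : F (T (Pi.single i 1), T (Pi.single i 1)) < c :=
      hF _ ⟨Pi.single i 1, single_mem_stdSimplex ℝ i, rfl⟩
    have hX : T (Pi.single i 1) = X i := by rw [Fintype.linearCombination_apply_single, one_smul]
    rw [hX, hsplit] at this
    exact this.le
  · rw [← hsplit]; exact (hd (Y₁, Y₂) ⟨h₁, h₂⟩).le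

end Separation

/-- Used along rays `Z + k Y` with `Y ≥ 0`: an upper set contains them, so a functional bounded
below on it is positive. -/
lemma nonneg_of_forall_le_add_nat_mul {a b d : ℝ} (h : ∀ k : ℕ, d ≤ a + k * b) : 0 ≤ b := by
  by_contra! hb
  obtain ⟨k, hk⟩ := exists_nat_gt ((a - d) / -b)
  rw [div_lt_iff₀ (by linarith)] at hk
  linarith [h k]

/-! ### Acceptance sets and their dual description. -/

section Acceptance

variable {Ω : Type*} [MeasurableSpace Ω] {P : Measure Ω} [IsProbabilityMeasure P]
  {p q : ℝ≥0∞} [hp1 : Fact (1 ≤ p)]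

/-- Dual separation of the portfolio returns from a pair of closed convex upper sets. -/
lemma exists_nonneg_separation (hpq : p.HolderConjugate q) {n : ℕ} (X : Fin n → Lp ℝ p P)
    {A₁ A₂ : Set (Lp ℝ p P)} (hA₁ : Convex ℝ A₁) (hA₂ : Convex ℝ A₂)
    (hc₁ : @IsClosed _ (payoffTopology P p q) A₁) (hc₂ : @IsClosed _ (payoffTopology P p q) A₂)
    (hu₁ : IsUpperSet A₁) (hu₂ : IsUpperSet A₂) (hn₁ : A₁.Nonempty) (hn₂ : A₂.Nonempty)
    (h : ∀ w ∈ stdSimplex ℝ (Fin n), portfolioReturn X w ∈ A₁ → portfolioReturn X w ∉ A₂) :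
    ∃ (V₁ V₂ : Lp ℝ q P) (c d : ℝ), 0 ≤ V₁ ∧ 0 ≤ V₂ ∧ c < d ∧
      (∀ i, pairing V₁ (X i) + pairing V₂ (X i) ≤ c) ∧
      ∀ Y₁ ∈ A₁, ∀ Y₂ ∈ A₂, d ≤ pairing V₁ Y₁ + pairing V₂ Y₂ := by
  obtain ⟨t₁, t₂, t₃⟩ := payoffTopology_locallyConvex (P := P) hpq
  obtain ⟨f, g, c, d, hcd, hX, hA⟩ := @exists_separation_simplex (Lp ℝ p P) _ _
    (payoffTopology P p q) t₁ t₂ t₃ n X A₁ A₂ hA₁ hA₂ hc₁ hc₂ h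
  obtain ⟨Z₁, hZ₁⟩ := hn₁
  obtain ⟨Z₂, hZ₂⟩ := hn₂
  have hup : ∀ {A : Set (Lp ℝ p P)}, IsUpperSet A → ∀ {Z Y : Lp ℝ p P}, Z ∈ A → 0 ≤ Y →
      ∀ k : ℕ, Z + (k : ℝ) • Y ∈ A := fun hu Z Y hZ hY k =>
    hu (le_add_of_nonneg_right (by rw [Nat.cast_smul_eq_nsmul]; exact nsmul_nonneg hY k)) hZ
  obtain ⟨V₁, hV₁, hf⟩ := exists_nonneg_pairing_eq hpq
    (@ContinuousLinearMap.toLinearMap _ _ _ _ _ _ (payoffTopology P p q) _ _ _ _ _ _ f)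
    (@ContinuousLinearMap.cont _ _ _ _ _ _ (payoffTopology P p q) _ _ _ _ _ _ f) (fun Y hY =>
      nonneg_of_forall_le_add_nat_mul (a := f Z₁ + g Z₂) (d := d) fun k => by
        have := hA _ (hup hu₁ hZ₁ hY k) _ hZ₂
        rw [map_add, map_smul, smul_eq_mul] at this
        have h' : ∀ x y z : ℝ, x + y + z = x + z + y := by intros; ring
        rw [h'] at this
        exact this)
  obtain ⟨V₂, hV₂, hg⟩ := exists_nonneg_pairing_eq hpq
    (@ContinuousLinearMap.toLinearMap _ _ _ _ _ _ (payoffTopology P p q) _ _ _ _ _ _ g)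
    (@ContinuousLinearMap.cont _ _ _ _ _ _ (payoffTopology P p q) _ _ _ _ _ _ g) (fun Y hY =>
      nonneg_of_forall_le_add_nat_mul (a := f Z₁ + g Z₂) (d := d) fun k => by
        have := hA _ hZ₁ _ (hup hu₂ hZ₂ hY k)
        rw [map_add, map_smul, smul_eq_mul, ← add_assoc] at this
        exact this)
  have hf' : ∀ Y, f Y = pairing V₁ Y := hf
  have hg' : ∀ Y, g Y = pairing V₂ Y := hg
  simp only [hf', hg'] at hX hA
  exact ⟨V₁, V₂, c, d, hV₁, hV₂, hcd, hX, hA⟩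

variable {ρ : Lp ℝ p P → EReal}

omit [IsProbabilityMeasure P] in
lemma convex_acceptanceSet (hρ : IsLscQuasiconvexRiskMeasure P p q ρ) (t : ℝ) :
    Convex ℝ (acceptanceSet ρ t) := by
  rw [convex_iff_forall_pos]
  intro Y hY Z hZ a b ha hb hab
  obtain rfl : b = 1 - a := by linarith
  exact (hρ.quasiconvex Y Z a ha (by linarith)).trans (max_le hY hZ)

omit [IsProbabilityMeasure P] in
lemma isUpperSet_acceptanceSet (hρ : IsLscQuasiconvexRiskMeasure P p q ρ) (t : ℝ) :
    IsUpperSet (acceptanceSet ρ t) := fun Y Z hYZ hY => (hρ.monotone Y Z hYZ).trans hY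

omit [IsProbabilityMeasure P] in
lemma isClosed_acceptanceSet (hρ : IsLscQuasiconvexRiskMeasure P p q ρ) (t : ℝ) :
    @IsClosed _ (payoffTopology P p q) (acceptanceSet ρ t) :=
  @LowerSemicontinuous.isClosed_preimage _ (payoffTopology P p q) _ _ _ hρ.lsc (t : EReal)

omit [IsProbabilityMeasure P] in
lemma lowerSemicontinuous_portfolioReturn (hpq : p.HolderConjugate q)
    (hρ : IsLscQuasiconvexRiskMeasure P p q ρ) {n : ℕ} (X : Fin n → Lp ℝ p P) :
    LowerSemicontinuous fun w : Fin n → ℝ => ρ (portfolioReturn X w) := by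
  obtain ⟨t₁, t₂, _⟩ := payoffTopology_locallyConvex (P := P) hpq
  exact @LowerSemicontinuous.comp _ _ _ (payoffTopology P p q) _ _ _ _ hρ.lsc
    (@continuous_sum_smul (Lp ℝ p P) _ _ (payoffTopology P p q) t₁ t₂ n X)

/-- A position is accepted as soon as no `V ∈ L^q_+` separates it from the acceptance set. -/
lemma mem_acceptanceSet_of_forall_le (hpq : p.HolderConjugate q)
    (hρ : IsLscQuasiconvexRiskMeasure P p q ρ) {t : ℝ} (hne : (acceptanceSet ρ t).Nonempty)
    {Y : Lp ℝ p P}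
    (h : ∀ V : Lp ℝ q P, 0 ≤ V → ((-pairing V Y : ℝ) : EReal) ≤ penalty ρ V t) :
    Y ∈ acceptanceSet ρ t := by
  by_contra hY
  -- A one-asset simplex is a point, and the second set is taken to be everything, so this separates
  -- `Y` from one acceptance set.
  obtain ⟨V, V', c, d, hV, -, hcd, hX, hA⟩ := exists_nonneg_separation hpq
    (fun _ : Fin 1 => Y) (convex_acceptanceSet hρ t) convex_univ (isClosed_acceptanceSet hρ t)
    (@isClosed_univ _ (payoffTopology P p q)) (isUpperSet_acceptanceSet hρ t) isUpperSet_univ hne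
    Set.univ_nonempty (fun w hw hm => by
      have : w 0 = 1 := by simpa using hw.2
      simp only [portfolioReturn, Fin.sum_univ_one, this, one_smul] at hm
      exact absurd hm hY)
  -- Taking `Y` itself as second coordinate makes `V'` cancel, so there is no need to show that it
  -- vanishes.
  have h1 : penalty ρ V t ≤ ((pairing V' Y - d : ℝ) : EReal) :=
    iSup₂_le fun Z hZ => EReal.coe_le_coe_iff.2 (by linarith [hA Z hZ Y trivial])
  have h2 := EReal.coe_le_coe_iff.1 ((h V hV).trans h1)
  linarith [hX 0]

end Acceptance

end QCPortfolio

namespace QCPortfolio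

/-! ### The primal feasibility problem, bisection and attainment. -/

section Feasibility

variable {Ω : Type*} [MeasurableSpace Ω] {P : Measure Ω} {p : ℝ≥0∞} {n : ℕ}
  {ρ₁ ρ₂ : Lp ℝ p P → EReal} {X : Fin n → Lp ℝ p P} {t r : ℝ}

lemma indicatorFn_nonneg {E : Type*} (A : Set E) (x : E) : 0 ≤ indicatorFn A x := by
  unfold indicatorFn; split_ifs <;> simp

lemma feasibilityValue_eq_zero (h : ∃ w, SolvesFeasibility ρ₁ ρ₂ X t r w) :
    feasibilityValue ρ₁ ρ₂ X t r = 0 := by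
  obtain ⟨w, hw, h₁, h₂⟩ := h
  refine le_antisymm ((iInf₂_le w hw).trans (by simp [indicatorFn, h₁, h₂]))
    (le_iInf₂ fun w _ => add_nonneg (indicatorFn_nonneg _ _) (indicatorFn_nonneg _ _))

lemma feasibilityValue_eq_top (h : ¬ ∃ w, SolvesFeasibility ρ₁ ρ₂ X t r w) :
    feasibilityValue ρ₁ ρ₂ X t r = ⊤ := by
  refine iInf₂_eq_top.2 fun w hw => ?_
  by_cases h₁ : portfolioReturn X w ∈ acceptanceSet ρ₁ t
  · have h₂ : portfolioReturn X w ∉ acceptanceSet ρ₂ r := fun h₂ => h ⟨w, hw, h₁, h₂⟩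
    simp [indicatorFn, h₁, h₂]
  · by_cases h₂ : portfolioReturn X w ∈ acceptanceSet ρ₂ r <;> simp [indicatorFn, h₁, h₂]

lemma feasibilityValue_eq_zero_iff :
    feasibilityValue ρ₁ ρ₂ X t r = 0 ↔ ∃ w, SolvesFeasibility ρ₁ ρ₂ X t r w := by
  refine ⟨fun h => ?_, feasibilityValue_eq_zero⟩
  by_contra hn
  simp [feasibilityValue_eq_top hn] at h

lemma portfolioValue_le_of_solves {w : Fin n → ℝ} (h : SolvesFeasibility ρ₁ ρ₂ X t r w) :
    portfolioValue ρ₁ ρ₂ X r ≤ t := by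
  obtain ⟨hw, h₁, h₂⟩ := h
  exact (iInf₂_le w ⟨hw, h₂⟩).trans h₁

lemma le_portfolioValue_of_not_solves (h : ¬ ∃ w, SolvesFeasibility ρ₁ ρ₂ X t r w) :
    (t : EReal) ≤ portfolioValue ρ₁ ρ₂ X r := by
  refine le_iInf₂ fun w hw => ?_
  by_contra! hlt
  exact h ⟨w, hw.1, hlt.le, hw.2⟩

/-- A feasible midpoint bounds the infimum from above. At an infeasible one every admissible
portfolio has larger risk, which bounds it from below. Neither direction needs attainment. -/
lemma bisection_bracket {l u : ℝ} (hl : (l : EReal) ≤ portfolioValue ρ₁ ρ₂ X r)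
    (hu : portfolioValue ρ₁ ρ₂ X r ≤ (u : EReal)) (k : ℕ) :
    ((bisection ρ₁ ρ₂ X r l u k).1 : EReal) ≤ portfolioValue ρ₁ ρ₂ X r ∧
      portfolioValue ρ₁ ρ₂ X r ≤ ((bisection ρ₁ ρ₂ X r l u k).2 : EReal) := by
  induction k with
  | zero => exact ⟨hl, hu⟩
  | succ k ih =>
    rw [bisection]
    split_ifs with h
    · obtain ⟨w, hw⟩ := feasibilityValue_eq_zero_iff.1 h
      exact ⟨ih.1, portfolioValue_le_of_solves hw⟩
    · exact ⟨le_portfolioValue_of_not_solves (mt feasibilityValue_eq_zero h), ih.2⟩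

lemma bisection_length (l u : ℝ) (k : ℕ) :
    (bisection ρ₁ ρ₂ X r l u k).2 - (bisection ρ₁ ρ₂ X r l u k).1 = (u - l) / 2 ^ k := by
  induction k with
  | zero => simp [bisection]
  | succ k ih =>
    rw [pow_succ, ← div_div, ← ih, bisection]
    split_ifs <;> ring

/-- The natural-number ceiling sends negative logarithms to `0`, which accounts for the maximum with
`0` in the step count. -/
lemma bisection_length_le {l u ε : ℝ} (hε : 0 < ε) (hlu : l ≤ u) :
    (bisection ρ₁ ρ₂ X r l u ⌈Real.logb 2 ((u - l) / ε)⌉₊).2 -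
      (bisection ρ₁ ρ₂ X r l u ⌈Real.logb 2 ((u - l) / ε)⌉₊).1 ≤ ε := by
  rw [bisection_length]
  rcases hlu.eq_or_lt with rfl | hlt
  -- Here `Real.logb 2 0 = 0`, so the step count is `0` and the interval is a point.
  · simpa using hε.le
  have h1 := Nat.le_ceil (Real.logb 2 ((u - l) / ε))
  rw [Real.logb_le_iff_le_rpow one_lt_two (div_pos (sub_pos.2 hlt) hε), Real.rpow_natCast,
    div_le_iff₀ hε] at h1
  rw [div_le_iff₀ (by positivity)]
  linarith

/-- The admissible portfolios form a closed subset of the simplex, and a lower semicontinuous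
function attains its infimum on a nonempty compact set. -/
lemma exists_solves_of_portfolioValue_le [Fact (1 ≤ p)] {q : ℝ≥0∞} (hpq : p.HolderConjugate q)
    (hρ₁ : IsLscQuasiconvexRiskMeasure P p q ρ₁) (hρ₂ : IsLscQuasiconvexRiskMeasure P p q ρ₂)
    (h : portfolioValue ρ₁ ρ₂ X r ≤ (t : EReal)) : ∃ w, SolvesFeasibility ρ₁ ρ₂ X t r w := by
  let S : Set (Fin n → ℝ) :=
    {w | w ∈ stdSimplex ℝ (Fin n) ∧ ρ₂ (portfolioReturn X w) ≤ (r : EReal)}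
  have hS : IsCompact S := (isCompact_stdSimplex ℝ (Fin n)).inter_right
    ((lowerSemicontinuous_portfolioReturn hpq hρ₂ X).isClosed_preimage (r : EReal))
  have hne : S.Nonempty := by
    by_contra hS'
    have : portfolioValue ρ₁ ρ₂ X r = ⊤ :=
      iInf₂_eq_top.2 fun w hw => absurd ⟨w, hw⟩ hS'
    rw [this] at h
    exact absurd h (not_le.2 (EReal.coe_lt_top t))
  obtain ⟨w, hw, hmin⟩ := LowerSemicontinuousOn.exists_isMinOn hne hS
    ((lowerSemicontinuous_portfolioReturn hpq hρ₁ X).lowerSemicontinuousOn S)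
  exact ⟨w, hw.1, (le_iInf₂ fun v hv => hmin hv).trans h, hw.2⟩

lemma le_portfolioValue_of_nonneg (hX : ∀ i, 0 ≤ X i)
    (hmono : ∀ Y₁ Y₂ : Lp ℝ p P, Y₁ ≤ Y₂ → ρ₁ Y₂ ≤ ρ₁ Y₁) :
    ρ₁ (portfolioReturn X fun _ => 1) ≤ portfolioValue ρ₁ ρ₂ X r := by
  refine le_iInf₂ fun w hw => hmono _ _ (Finset.sum_le_sum fun i _ => ?_)
  have hw1 : w i ≤ 1 := by
    rw [← hw.1.2]
    exact Finset.single_le_sum (fun j _ => hw.1.1 j) (Finset.mem_univ i)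
  rw [← Lp.coeFn_le]
  filter_upwards [Lp.coeFn_smul (w i) (X i), Lp.coeFn_smul (1 : ℝ) (X i),
    (Lp.coeFn_nonneg (X i)).2 (hX i)] with ω h1 h2 h3
  rw [h1, h2]
  exact mul_le_mul_of_nonneg_right hw1 h3

end Feasibility

/-! ### Weak and strong duality, and multipliers. -/

section Duality

variable {Ω : Type*} [MeasurableSpace Ω] {P : Measure Ω} {p q : ℝ≥0∞} {n : ℕ}
  {ρ ρ₁ ρ₂ : Lp ℝ p P → EReal} {X : Fin n → Lp ℝ p P} {t r : ℝ}

lemma neg_pairing_le_penalty (V : Lp ℝ q P) {Y : Lp ℝ p P} (hY : Y ∈ acceptanceSet ρ t) :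
    ((-pairing V Y : ℝ) : EReal) ≤ penalty ρ V t :=
  le_iSup₂ (f := fun (Y : Lp ℝ p P) (_ : Y ∈ acceptanceSet ρ t) =>
    ((-pairing V Y : ℝ) : EReal)) Y hY

lemma penalty_eq_bot (V : Lp ℝ q P) (h : ¬ (acceptanceSet ρ t).Nonempty) :
    penalty ρ V t = ⊥ :=
  iSup₂_eq_bot.2 fun Y hY => absurd ⟨Y, hY⟩ h

/-- The Slater condition enters through this: an empty acceptance set would have penalty `-∞`. -/
lemma acceptanceSet_nonempty_of_penalty {V : Lp ℝ q P} {a : ℝ} (h : penalty ρ V t = a) :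
    (acceptanceSet ρ t).Nonempty := by
  by_contra hn
  rw [penalty_eq_bot V hn] at h
  exact EReal.bot_ne_coe a h

lemma dualObjective_le {V₁ V₂ : Lp ℝ q P} {Y₁ Y₂ : Lp ℝ p P} (h₁ : Y₁ ∈ acceptanceSet ρ₁ t)
    (h₂ : Y₂ ∈ acceptanceSet ρ₂ r) (y : ℝ) :
    dualObjective ρ₁ ρ₂ t r V₁ V₂ y ≤ ((pairing V₁ Y₁ + pairing V₂ Y₂ - y : ℝ) : EReal) := by
  have e₁ := EReal.neg_le_neg_iff.2 (neg_pairing_le_penalty V₁ h₁)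
  have e := EReal.sub_le_sub (EReal.sub_le_sub e₁ (neg_pairing_le_penalty V₂ h₂)) (le_refl (y : EReal))
  refine e.trans (le_of_eq ?_)
  rw [← EReal.coe_neg, ← EReal.coe_sub, ← EReal.coe_sub, neg_neg, sub_neg_eq_add]

lemma le_dualObjective (hn₁ : (acceptanceSet ρ₁ t).Nonempty) (hn₂ : (acceptanceSet ρ₂ r).Nonempty)
    {V₁ V₂ : Lp ℝ q P} {d : ℝ}
    (h : ∀ Y₁ ∈ acceptanceSet ρ₁ t, ∀ Y₂ ∈ acceptanceSet ρ₂ r, d ≤ pairing V₁ Y₁ + pairing V₂ Y₂)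
    (y : ℝ) : ((d - y : ℝ) : EReal) ≤ dualObjective ρ₁ ρ₂ t r V₁ V₂ y := by
  obtain ⟨Z₁, hZ₁⟩ := hn₁
  obtain ⟨Z₂, hZ₂⟩ := hn₂
  have h2 : ∀ Y₁ ∈ acceptanceSet ρ₁ t,
      penalty ρ₂ V₂ r ≤ ((pairing V₁ Y₁ - d : ℝ) : EReal) := fun Y₁ h₁ =>
    iSup₂_le fun Y₂ h₂ => EReal.coe_le_coe_iff.2 (by linarith [h Y₁ h₁ Y₂ h₂])
  -- Once the second penalty is known to be real, the joint bound `d` can be split into one supremum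
  -- at a time without meeting `∞ - ∞`.
  obtain ⟨a₂, ha₂⟩ : ∃ a : ℝ, penalty ρ₂ V₂ r = a :=
    ⟨_, (EReal.coe_toReal (ne_top_of_le_ne_top (EReal.coe_ne_top _) (h2 Z₁ hZ₁))
      (ne_bot_of_le_ne_bot (EReal.coe_ne_bot _) (neg_pairing_le_penalty V₂ hZ₂))).symm⟩
  have h1 : penalty ρ₁ V₁ t ≤ ((-d - a₂ : ℝ) : EReal) :=
    iSup₂_le fun Y₁ h₁ => EReal.coe_le_coe_iff.2 (by
      have := h2 Y₁ h₁
      rw [ha₂, EReal.coe_le_coe_iff] at this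
      linarith)
  have e := EReal.sub_le_sub (EReal.sub_le_sub (EReal.neg_le_neg_iff.2 h1) ha₂.le)
    (le_refl (y : EReal))
  refine le_trans (le_of_eq ?_) e
  rw [← EReal.coe_neg, ← EReal.coe_sub, ← EReal.coe_sub]
  congr 1
  ring

variable [Fact (1 ≤ p)]

lemma pairing_zero_left (hpq : p.HolderConjugate q) (Y : Lp ℝ p P) :
    pairing (0 : Lp ℝ q P) Y = 0 := by
  rw [pairing_eq_pairingₗ hpq, map_zero]

lemma pairing_smul_left (hpq : p.HolderConjugate q) (c : ℝ) (V : Lp ℝ q P) (Y : Lp ℝ p P) :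
    pairing (c • V) Y = c * pairing V Y := by
  rw [pairing_eq_pairingₗ hpq, pairing_eq_pairingₗ hpq, map_smul, smul_eq_mul]

lemma pairing_portfolioReturn (hpq : p.HolderConjugate q) (V : Lp ℝ q P) (w : Fin n → ℝ) :
    pairing V (portfolioReturn X w) = ∑ i, w i * pairing V (X i) := by
  simp [pairing_eq_pairingₗ hpq, portfolioReturn]

lemma penalty_zero (hpq : p.HolderConjugate q) (h : (acceptanceSet ρ t).Nonempty) :
    penalty ρ (0 : Lp ℝ q P) t = 0 := by
  simp only [penalty, pairing_zero_left hpq, neg_zero, EReal.coe_zero]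
  exact biSup_const h

lemma zero_mem_dualFeasible (hpq : p.HolderConjugate q) :
    ((0, 0, 0) : Lp ℝ q P × Lp ℝ q P × ℝ) ∈ dualFeasible q X :=
  ⟨le_rfl, le_rfl, fun i => by simp [pairing_zero_left hpq]⟩

lemma dualValue_eq_zero (hpq : p.HolderConjugate q)
    (h : ∃ w, SolvesFeasibility ρ₁ ρ₂ X t r w) : dualValue q ρ₁ ρ₂ X t r = 0 := by
  obtain ⟨w, hw, h₁, h₂⟩ := h
  refine le_antisymm (iSup₂_le fun z hz => ?_) ?_
  · refine (dualObjective_le h₁ h₂ _).trans ?_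
    rw [← EReal.coe_zero, EReal.coe_le_coe_iff, pairing_portfolioReturn hpq,
      pairing_portfolioReturn hpq, ← Finset.sum_add_distrib]
    simp_rw [← mul_add]
    have := Finset.sum_le_sum fun i (_ : i ∈ Finset.univ) =>
      mul_le_mul_of_nonneg_left (hz.2.2 i) (hw.1 i)
    rw [← Finset.sum_mul, hw.2, one_mul] at this
    linarith
  · refine le_trans (le_of_eq ?_) (le_iSup₂ (f := fun (z : Lp ℝ q P × Lp ℝ q P × ℝ)
      (_ : z ∈ dualFeasible q X) => dualObjective ρ₁ ρ₂ t r z.1 z.2.1 z.2.2) (0, 0, 0)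
        (zero_mem_dualFeasible hpq))
    simp [dualObjective, penalty_zero hpq ⟨_, h₁⟩, penalty_zero hpq ⟨_, h₂⟩]

/-- Since the weights sum to `1`, the terms in `y` cancel. Bounding the penalties at the return of
`w` cancels the rest, and the origin attains `0`. -/
lemma isOptimalMultiplier_of_solves (hpq : p.HolderConjugate q) {w : Fin n → ℝ}
    (h : SolvesFeasibility ρ₁ ρ₂ X t r w) : IsOptimalMultiplier q ρ₁ ρ₂ X t r w := by
  refine ⟨h.1.1, ?_⟩
  rw [dualValue_eq_zero hpq ⟨w, h⟩]
  obtain ⟨hw, h₁, h₂⟩ := h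
  refine le_antisymm (iSup₂_le fun z hz => ?_) ?_
  · refine (EReal.sub_le_sub (dualObjective_le h₁ h₂ _) le_rfl).trans (le_of_eq ?_)
    rw [← EReal.coe_sub, ← EReal.coe_zero, pairing_portfolioReturn hpq,
      pairing_portfolioReturn hpq]
    congr 1
    simp only [mul_sub, mul_add, Finset.sum_sub_distrib, Finset.sum_add_distrib]
    rw [← Finset.sum_mul, hw.2]
    ring
  · refine le_trans (le_of_eq ?_) (le_iSup₂ (f := fun (z : Lp ℝ q P × Lp ℝ q P × ℝ)
      (_ : z ∈ {z : Lp ℝ q P × Lp ℝ q P × ℝ | 0 ≤ z.1 ∧ 0 ≤ z.2.1}) =>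
        lagrangian ρ₁ ρ₂ X t r w z.1 z.2.1 z.2.2) (0, 0, 0) ⟨le_rfl, le_rfl⟩)
    simp [lagrangian, dualObjective, penalty_zero hpq ⟨_, h₁⟩, penalty_zero hpq ⟨_, h₂⟩,
      pairing_zero_left hpq]

lemma neg_coe_le_of_neg_sub_nonpos {a : EReal} {b : ℝ} (h : -a - (b : EReal) ≤ 0) :
    ((-b : ℝ) : EReal) ≤ a := by
  induction a with
  | bot => simp at h
  | top => exact le_top
  | coe a =>
    rw [← EReal.coe_neg, ← EReal.coe_sub, ← EReal.coe_zero, EReal.coe_le_coe_iff] at h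
    rw [EReal.coe_le_coe_iff]
    linarith

variable [IsProbabilityMeasure P]

lemma dualValue_eq_top (hpq : p.HolderConjugate q) (hρ₁ : IsLscQuasiconvexRiskMeasure P p q ρ₁)
    (hρ₂ : IsLscQuasiconvexRiskMeasure P p q ρ₂)
    (h : ¬ ∃ w, SolvesFeasibility ρ₁ ρ₂ X t r w) : dualValue q ρ₁ ρ₂ X t r = ⊤ := by
  have hle : ∀ z ∈ dualFeasible q X, dualObjective ρ₁ ρ₂ t r z.1 z.2.1 z.2.2 ≤
      dualValue q ρ₁ ρ₂ X t r := fun z hz =>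
    le_iSup₂ (f := fun (z : Lp ℝ q P × Lp ℝ q P × ℝ)
      (_ : z ∈ dualFeasible q X) => dualObjective ρ₁ ρ₂ t r z.1 z.2.1 z.2.2) z hz
  have h0 := hle _ (zero_mem_dualFeasible hpq)
  -- Separation needs both acceptance sets nonempty. If one is empty, its penalty is `-∞` and the
  -- origin already has objective `+∞`.
  by_cases hn₁ : (acceptanceSet ρ₁ t).Nonempty
  swap
  · rw [← top_le_iff]
    refine le_trans (le_of_eq ?_) h0
    by_cases hn₂ : (acceptanceSet ρ₂ r).Nonempty
    · simp [dualObjective, penalty_eq_bot _ hn₁, penalty_zero hpq hn₂]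
    · simp [dualObjective, penalty_eq_bot _ hn₁, penalty_eq_bot _ hn₂]
  by_cases hn₂ : (acceptanceSet ρ₂ r).Nonempty
  swap
  · rw [← top_le_iff]
    refine le_trans (le_of_eq ?_) h0
    simp [dualObjective, penalty_eq_bot _ hn₂, penalty_zero hpq hn₁]
  obtain ⟨V₁, V₂, c, d, hV₁, hV₂, hcd, hX, hA⟩ := exists_nonneg_separation hpq X
    (convex_acceptanceSet hρ₁ t) (convex_acceptanceSet hρ₂ r)
    (isClosed_acceptanceSet hρ₁ t) (isClosed_acceptanceSet hρ₂ r)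
    (isUpperSet_acceptanceSet hρ₁ t) (isUpperSet_acceptanceSet hρ₂ r) hn₁ hn₂
    (fun w hw h₁ h₂ => h ⟨w, hw, h₁, h₂⟩)
  rw [EReal.eq_top_iff_forall_lt]
  intro M
  -- The `k`-fold multiple of the separating triple stays feasible, and its objective is at least `k
  -- * (d - c) > M`.
  obtain ⟨k, hk⟩ := exists_nat_gt (M / (d - c))
  rw [div_lt_iff₀ (sub_pos.2 hcd)] at hk
  have hnn : ∀ {V : Lp ℝ q P}, 0 ≤ V → 0 ≤ (k : ℝ) • V := fun hV => by
    rw [Nat.cast_smul_eq_nsmul]; exact nsmul_nonneg hV k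
  have hfeas : (((k : ℝ) • V₁, (k : ℝ) • V₂, (k : ℝ) * c) : Lp ℝ q P × Lp ℝ q P × ℝ) ∈
      dualFeasible q X := ⟨hnn hV₁, hnn hV₂, fun i => by
    simp only [pairing_smul_left hpq, ← mul_add]
    exact mul_le_mul_of_nonneg_left (hX i) k.cast_nonneg⟩
  refine lt_of_lt_of_le ?_ ((le_dualObjective hn₁ hn₂ (d := k * d) (fun Y₁ h₁ Y₂ h₂ => ?_)
    (k * c)).trans (hle _ hfeas))
  · rw [EReal.coe_lt_coe_iff]; linarith
  · simp only [pairing_smul_left hpq, ← mul_add]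
    exact mul_le_mul_of_nonneg_left (hA Y₁ h₁ Y₂ h₂) k.cast_nonneg

/-- Strong duality for the feasibility problem. -/
lemma dualValue_eq_feasibilityValue (hpq : p.HolderConjugate q)
    (hρ₁ : IsLscQuasiconvexRiskMeasure P p q ρ₁) (hρ₂ : IsLscQuasiconvexRiskMeasure P p q ρ₂) :
    dualValue q ρ₁ ρ₂ X t r = feasibilityValue ρ₁ ρ₂ X t r := by
  by_cases h : ∃ w, SolvesFeasibility ρ₁ ρ₂ X t r w
  · rw [dualValue_eq_zero hpq h, feasibilityValue_eq_zero h]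
  · rw [dualValue_eq_top hpq hρ₁ hρ₂ h, feasibilityValue_eq_top h]

lemma exists_solves_of_isDualOptimal (hpq : p.HolderConjugate q)
    (hρ₁ : IsLscQuasiconvexRiskMeasure P p q ρ₁) (hρ₂ : IsLscQuasiconvexRiskMeasure P p q ρ₂)
    (hn₁ : (acceptanceSet ρ₁ t).Nonempty) (hn₂ : (acceptanceSet ρ₂ r).Nonempty)
    {V₁ V₂ : Lp ℝ q P} {y : ℝ} (hopt : IsDualOptimal ρ₁ ρ₂ X t r V₁ V₂ y) :
    ∃ w, SolvesFeasibility ρ₁ ρ₂ X t r w := by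
  by_contra h
  obtain ⟨Z₁, hZ₁⟩ := hn₁
  obtain ⟨Z₂, hZ₂⟩ := hn₂
  have h1 := dualObjective_le (V₁ := V₁) (V₂ := V₂) hZ₁ hZ₂ y
  rw [hopt.2, dualValue_eq_top hpq hρ₁ hρ₂ h] at h1
  exact absurd h1 (not_le.2 (EReal.coe_lt_top _))

/-- If the feasibility problem is solvable, every optimal multiplier of its dual solves it. -/
lemma solves_of_isOptimalMultiplier (hpq : p.HolderConjugate q)
    (hρ₁ : IsLscQuasiconvexRiskMeasure P p q ρ₁) (hρ₂ : IsLscQuasiconvexRiskMeasure P p q ρ₂)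
    (hs : ∃ w, SolvesFeasibility ρ₁ ρ₂ X t r w) {w : Fin n → ℝ}
    (hw : IsOptimalMultiplier q ρ₁ ρ₂ X t r w) : SolvesFeasibility ρ₁ ρ₂ X t r w := by
  obtain ⟨hw0, hval⟩ := hw
  rw [dualValue_eq_zero hpq hs] at hval
  obtain ⟨v, -, hv₁, hv₂⟩ := hs
  have hn₁ : (acceptanceSet ρ₁ t).Nonempty := ⟨_, hv₁⟩
  have hn₂ : (acceptanceSet ρ₂ r).Nonempty := ⟨_, hv₂⟩
  have hL : ∀ (V₁ V₂ : Lp ℝ q P) (y : ℝ), 0 ≤ V₁ → 0 ≤ V₂ →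
      lagrangian ρ₁ ρ₂ X t r w V₁ V₂ y ≤ 0 := fun V₁ V₂ y h₁ h₂ => by
    rw [← hval]
    exact le_iSup₂ (f := fun (z : Lp ℝ q P × Lp ℝ q P × ℝ)
      (_ : z ∈ {z : Lp ℝ q P × Lp ℝ q P × ℝ | 0 ≤ z.1 ∧ 0 ≤ z.2.1}) =>
        lagrangian ρ₁ ρ₂ X t r w z.1 z.2.1 z.2.2) (V₁, V₂, y) ⟨h₁, h₂⟩
  -- With `V₁ = V₂ = 0` the Lagrangian is linear in `y`, so boundedness above forces its slope to
  -- vanish.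
  have hy : ∀ y : ℝ, y * ∑ i, w i ≤ y := fun y => by
    have := hL 0 0 y le_rfl le_rfl
    simp only [lagrangian, dualObjective, penalty_zero hpq hn₁, penalty_zero hpq hn₂,
      pairing_zero_left hpq, neg_zero, sub_zero, add_zero, zero_sub] at this
    rw [← EReal.coe_neg, ← EReal.coe_sub, ← EReal.coe_zero, EReal.coe_le_coe_iff] at this
    simp only [mul_neg, Finset.sum_neg_distrib, ← Finset.sum_mul] at this
    linarith
  have hsum : ∑ i, w i = 1 := by
    have h1 := hy 1
    have h2 := hy (-1)
    linarith
  refine ⟨⟨hw0, hsum⟩, mem_acceptanceSet_of_forall_le hpq hρ₁ hn₁ fun V hV => ?_,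
    mem_acceptanceSet_of_forall_le hpq hρ₂ hn₂ fun V hV => ?_⟩
  -- With the other variables zero, the Lagrangian bound is the dual acceptance criterion for the
  -- return of `w`.
  · have := hL V 0 0 hV le_rfl
    simp only [lagrangian, dualObjective, penalty_zero hpq hn₂,
      pairing_zero_left hpq, sub_zero, add_zero, EReal.coe_zero] at this
    rw [pairing_portfolioReturn hpq]
    exact neg_coe_le_of_neg_sub_nonpos this
  · have := hL 0 V 0 le_rfl hV
    simp only [lagrangian, dualObjective, penalty_zero hpq hn₁, neg_zero, zero_sub,
      pairing_zero_left hpq, sub_zero, zero_add, EReal.coe_zero] at this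
    rw [pairing_portfolioReturn hpq]
    exact neg_coe_le_of_neg_sub_nonpos this

end Duality

end QCPortfolio

theorem theorem3 {Ω : Type*} [MeasurableSpace Ω] (P : Measure Ω) [IsProbabilityMeasure P]
    (p q : ℝ≥0∞) [Fact (1 ≤ p)] (hpq : p.HolderConjugate q)
    (n : ℕ) (hn : 1 ≤ n) (X : Fin n → Lp ℝ p P)
    (ρ₁ ρ₂ : Lp ℝ p P → EReal)
    (hρ₁ : IsLscQuasiconvexRiskMeasure P p q ρ₁)
    (hρ₂ : IsLscQuasiconvexRiskMeasure P p q ρ₂) (r : ℝ) :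
    -- (i) and (ii), at every level `t`
    (∀ t : ℝ,
      (((∃ w, SolvesFeasibility ρ₁ ρ₂ X t r w) → feasibilityValue ρ₁ ρ₂ X t r = 0) ∧
        ((¬ ∃ w, SolvesFeasibility ρ₁ ρ₂ X t r w) → feasibilityValue ρ₁ ρ₂ X t r = ⊤) ∧
        dualValue q ρ₁ ρ₂ X t r = feasibilityValue ρ₁ ρ₂ X t r) ∧
      (SlaterCondition q ρ₁ ρ₂ t r →
        (∃ (V₁ V₂ : Lp ℝ q P) (y : ℝ), IsDualOptimal ρ₁ ρ₂ X t r V₁ V₂ y) →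
        (∃ w, IsOptimalMultiplier q ρ₁ ρ₂ X t r w) ∧
          ∀ w, IsOptimalMultiplier q ρ₁ ρ₂ X t r w → SolvesFeasibility ρ₁ ρ₂ X t r w)) ∧
    -- bisection from any bracket of the optimal value
    (∀ l u ε : ℝ, 0 < ε →
      (l : EReal) ≤ portfolioValue ρ₁ ρ₂ X r → portfolioValue ρ₁ ρ₂ X r ≤ (u : EReal) →
      (∃ K : ℕ, K ≤ ⌈Real.logb 2 ((u - l) / ε)⌉₊ ∧
        (bisection ρ₁ ρ₂ X r l u K).2 - (bisection ρ₁ ρ₂ X r l u K).1 ≤ ε) ∧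
      ∀ K : ℕ,
        ((bisection ρ₁ ρ₂ X r l u K).1 : EReal) ≤ portfolioValue ρ₁ ρ₂ X r ∧
        portfolioValue ρ₁ ρ₂ X r ≤ ((bisection ρ₁ ρ₂ X r l u K).2 : EReal) ∧
        ((bisection ρ₁ ρ₂ X r l u K).2 - (bisection ρ₁ ρ₂ X r l u K).1 ≤ ε →
          SlaterCondition q ρ₁ ρ₂ (bisection ρ₁ ρ₂ X r l u K).2 r →
          (∃ w, IsOptimalMultiplier q ρ₁ ρ₂ X (bisection ρ₁ ρ₂ X r l u K).2 r w) ∧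
            ∀ w, IsOptimalMultiplier q ρ₁ ρ₂ X (bisection ρ₁ ρ₂ X r l u K).2 r w →
              w ∈ stdSimplex ℝ (Fin n) ∧
              ρ₂ (portfolioReturn X w) ≤ (r : EReal) ∧
              portfolioValue ρ₁ ρ₂ X r ≤ ρ₁ (portfolioReturn X w) ∧
              ρ₁ (portfolioReturn X w) ≤ portfolioValue ρ₁ ρ₂ X r + (ε : EReal))) ∧
    -- the explicit initial bracket
    ((∀ i, 0 ≤ X i) → ∀ (l u : ℝ) (w₀ : Fin n → ℝ),
      ρ₁ (portfolioReturn X (fun _ => 1)) = (l : EReal) →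
      w₀ ∈ stdSimplex ℝ (Fin n) → ρ₁ (portfolioReturn X w₀) = (u : EReal) →
      ρ₂ (portfolioReturn X w₀) ≤ (r : EReal) →
      (l : EReal) ≤ portfolioValue ρ₁ ρ₂ X r ∧ portfolioValue ρ₁ ρ₂ X r ≤ (u : EReal)) := by
  refine ⟨fun t => ⟨⟨feasibilityValue_eq_zero, feasibilityValue_eq_top,
    dualValue_eq_feasibilityValue hpq hρ₁ hρ₂⟩, ?_⟩, fun l u ε hε hl hu => ⟨?_, fun K => ?_⟩, ?_⟩
  · rintro ⟨U₁, U₂, -, -, ⟨a₁, ha₁⟩, ⟨a₂, ha₂⟩⟩ ⟨V₁, V₂, y, hopt⟩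
    have hs := exists_solves_of_isDualOptimal hpq hρ₁ hρ₂ (acceptanceSet_nonempty_of_penalty ha₁)
      (acceptanceSet_nonempty_of_penalty ha₂) hopt
    exact ⟨hs.imp fun w hw => isOptimalMultiplier_of_solves hpq hw,
      fun w hw => solves_of_isOptimalMultiplier hpq hρ₁ hρ₂ hs hw⟩
  · exact ⟨_, le_rfl, bisection_length_le hε (EReal.coe_le_coe_iff.1 (hl.trans hu))⟩
  · obtain ⟨hlK, huK⟩ := bisection_bracket hl hu K
    refine ⟨hlK, huK, fun hlen _ => ?_⟩
    -- Attainment is essential here: `u_K` may be the initial `u`, which the bisection never tested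
    -- for feasibility.
    have hs := exists_solves_of_portfolioValue_le hpq hρ₁ hρ₂ huK
    refine ⟨hs.imp fun w hw => isOptimalMultiplier_of_solves hpq hw, fun w hw => ?_⟩
    obtain ⟨hw, h₁, h₂⟩ := solves_of_isOptimalMultiplier hpq hρ₁ hρ₂ hs hw
    refine ⟨hw, h₂, iInf₂_le w ⟨hw, h₂⟩, h₁.trans ?_⟩
    refine le_trans ?_ (add_le_add_left hlK (ε : EReal))
    rw [← EReal.coe_add, EReal.coe_le_coe_iff]
    linarith
  · intro hX l u w₀ hl hw₀ hu hr
    exact ⟨hl ▸ le_portfolioValue_of_nonneg hX hρ₁.monotone, hu ▸ iInf₂_le w₀ ⟨hw₀, hr⟩⟩
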